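/- For integers $s,t\ge 0$ let $\mathbb{R}^{s,t}$ be $\mathbb{R}^{s+t}$ with the quadratic form $q(x,y)=x_1^2+\dots+x_s^2-y_1^2-\dots-y_t^2$, and let $\mathcal{G}(\mathbb{R}^{s,t})$ be its geometric (Clifford) algebra, i.e. the tensor algebra modulo the relations $v^2=q(v)$; let $\mathcal{G}^+(\mathbb{R}^{s,t})$ be its even subalgebra. Let $\mathcal{G}(\mathbb{C}^n)$ be the complex Clifford algebra of $z_1^2+\dots+z_n^2$ on $\mathbb{C}^n$. In particular $\mathcal{G}(\mathbb{R}^{0,0})=\mathbb{R}$ and $\mathcal{G}(\mathbb{C}^0)=\mathbb{C}$. Write $\mathbb{F}[N]=\mathbb{F}^{N\times N}$ and ${}^2\mathbb{F}[N]=\mathbb{F}[N]\oplus\mathbb{F}[N]$ (with $\mathbb F[1]=\mathbb F$). Tensor products without subscript are over $\mathbb{R}$, and all isomorphisms are of unital associative $\mathbb{R}$-algebras unless stated otherwise. (1) For $0\le s,t\le 8$, $\mathcal{G}(\mathbb{R}^{s,t})$ is isomorphic to the algebra in column $s$ and row $t$ of the table $$ \begin{array}{c||c|c|c|c|c|c|c|c|c}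 8&\mathbb{R}[16]&{}^2\mathbb{R}[16]&\mathbb{R}[32]&\mathbb{C}[32]&\mathbb{H}[32]&{}^2\mathbb{H}[32]&\mathbb{H}[64]&\mathbb{C}[128]&\mathbb{R}[256]\\ 7&{}^2\mathbb{R}[8]&\mathbb{R}[16]&\mathbb{C}[16]&\mathbb{H}[16]&{}^2\mathbb{H}[16]&\mathbb{H}[32]&\mathbb{C}[64]&\mathbb{R}[128]&{}^2\mathbb{R}[128]\\ 6&\mathbb{R}[8]&\mathbb{C}[8]&\mathbb{H}[8]&{}^2\mathbb{H}[8]&\mathbb{H}[16]&\mathbb{C}[32]&\mathbb{R}[64]&{}^2\mathbb{R}[64]&\mathbb{R}[128]\\ 5&\mathbb{C}[4]&\mathbb{H}[4]&{}^2\mathbb{H}[4]&\mathbb{H}[8]&\mathbb{C}[16]&\mathbb{R}[32]&{}^2\mathbb{R}[32]&\mathbb{R}[64]&\mathbb{C}[64]\\ 4&\mathbb{H}[2]&{}^2\mathbb{H}[2]&\mathbb{H}[4]&\mathbb{C}[8]&\mathbb{R}[16]&{}^2\mathbb{R}[16]&\mathbb{R}[32]&\mathbb{C}[32]&\mathbb{H}[32]\\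 3&{}^2\mathbb{H}[1]&\mathbb{H}[2]&\mathbb{C}[4]&\mathbb{R}[8]&{}^2\mathbb{R}[8]&\mathbb{R}[16]&\mathbb{C}[16]&\mathbb{H}[16]&{}^2\mathbb{H}[16]\\ 2&\mathbb{H}[1]&\mathbb{C}[2]&\mathbb{R}[4]&{}^2\mathbb{R}[4]&\mathbb{R}[8]&\mathbb{C}[8]&\mathbb{H}[8]&{}^2\mathbb{H}[8]&\mathbb{H}[16]\\ 1&\mathbb{C}[1]&\mathbb{R}[2]&{}^2\mathbb{R}[2]&\mathbb{R}[4]&\mathbb{C}[4]&\mathbb{H}[4]&{}^2\mathbb{H}[4]&\mathbb{H}[8]&\mathbb{C}[16]\\ 0&\mathbb{R}[1]&{}^2\mathbb{R}[1]&\mathbb{R}[2]&\mathbb{C}[2]&\mathbb{H}[2]&{}^2\mathbb{H}[2]&\mathbb{H}[4]&\mathbb{C}[8]&\mathbb{R}[16]\\ \hline\hline t/s&0&1&2&3&4&5&6&7&8 \end{array} $$ (2) For all $s,t\ge0$: $\mathcal{G}(\mathbb{R}^{s+8,t})\cong\mathcal{G}(\mathbb{R}^{s,t+8})\cong\mathcal{G}(\mathbb{R}^{s,t})\otimes\mathbb{R}^{16\times16}$.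 Consequently, for $0\le s,t\le 8$ and $a,b\ge 0$, $\mathcal{G}(\mathbb{R}^{s+8a,t+8b})$ is isomorphic to the algebra in box $(s,t)$ of the table with every matrix size $N$ replaced by $16^{a+b}N$; so every $\mathcal{G}(\mathbb{R}^{s,t})$ is a matrix algebra over $\mathbb{R}$, $\mathbb{C}$ or $\mathbb{H}$, or a direct sum of two copies of one. (3) For all $s\geq 0$, $t\ge1$: $\mathcal{G}^+(\mathbb{R}^{s,t})\cong\mathcal{G}(\mathbb{R}^{s,t-1})$; for all $s\ge1$, $t\ge 0$: $\mathcal{G}^+(\mathbb{R}^{s,t})\cong\mathcal{G}(\mathbb{R}^{t,s-1})$. (4) For all $n,s,t\ge0$: $\mathcal{G}(\mathbb{R}^{n+2,0})\cong\mathcal{G}(\mathbb{R}^{0,n})\otimes\mathcal{G}(\mathbb{R}^{2,0})$, $\mathcal{G}(\mathbb{R}^{0,n+2})\cong\mathcal{G}(\mathbb{R}^{n,0})\otimes\mathcal{G}(\mathbb{R}^{0,2})$, and $\mathcal{G}(\mathbb{R}^{s+1,t+1})\cong\mathcal{G}(\mathbb{R}^{s,t})\otimes\mathcal{G}(\mathbb{R}^{1,1})$.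 (5) For all $n\ge0$: $\mathcal{G}(\mathbb{R}^{n+8,0})\cong\mathcal{G}(\mathbb{R}^{n,0})\otimes\mathcal{G}(\mathbb{R}^{8,0})$, $\mathcal{G}(\mathbb{R}^{0,n+8})\cong\mathcal{G}(\mathbb{R}^{0,n})\otimes\mathcal{G}(\mathbb{R}^{0,8})$, and, as $\mathbb{C}$-algebras, $\mathcal{G}(\mathbb{C}^{n+2})\cong\mathcal{G}(\mathbb{C}^n)\otimes_{\mathbb{C}}\mathcal{G}(\mathbb{C}^2)$. (6) $\mathbb{C}\otimes\mathbb{C}\cong\mathbb{C}\oplus\mathbb{C}$, $\mathbb{C}\otimes\mathbb{H}\cong\mathbb{C}^{2\times2}$, and $\mathbb{H}\otimes\mathbb{H}\cong\mathbb{R}^{4\times4}$. -/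

import Mathlib

open scoped TensorProduct

/-- The standard quadratic form of signature `(s, t)` on `ℝ^(s+t)`:
`x₁² + ⋯ + x_s² - y₁² - ⋯ - y_t²`. -/
noncomputable def signatureForm (s t : ℕ) : QuadraticForm ℝ (Fin s ⊕ Fin t → ℝ) :=
  QuadraticMap.weightedSumSquares ℝ (Sum.elim (fun _ : Fin s => (1 : ℝ)) (fun _ : Fin t => (-1 : ℝ)))

/-- The geometric algebra `𝒢(ℝ^{s,t})`, with the convention `v² = q(v)`. -/
noncomputable abbrev RealGeomAlg (s t : ℕ) : Type := CliffordAlgebra (signatureForm s t)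

/-- The even subalgebra `𝒢⁺(ℝ^{s,t})`. -/
noncomputable abbrev RealGeomAlgEven (s t : ℕ) : Subalgebra ℝ (RealGeomAlg s t) :=
  CliffordAlgebra.even (signatureForm s t)

/-- The standard nondegenerate quadratic form `z₁² + ⋯ + z_n²` on `ℂ^n`. -/
noncomputable def complexForm (n : ℕ) : QuadraticForm ℂ (Fin n → ℂ) :=
  QuadraticMap.weightedSumSquares ℂ (fun _ : Fin n => (1 : ℂ))

/-- The complex geometric algebra `𝒢(ℂ^n)`. -/
noncomputable abbrev ComplexGeomAlg (n : ℕ) : Type := CliffordAlgebra (complexForm n)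

/-- The matrix algebra `F[N] = F^{N × N}`. -/
abbrev SqMat (F : Type) (N : ℕ) : Type := Matrix (Fin N) (Fin N) F

/-- The shapes of entries of the classification table:
`R N`, `C N`, `H N` stand for `ℝ[N]`, `ℂ[N]`, `ℍ[N]`, and
`RR N`, `HH N` for `ℝ[N] ⊕ ℝ[N]`, `ℍ[N] ⊕ ℍ[N]`. -/
inductive BoxEntry : Type
  | R (N : ℕ)
  | C (N : ℕ)
  | H (N : ℕ)
  | RR (N : ℕ)
  | HH (N : ℕ)

namespace BoxEntry

/-- `e.Describes A`: the real algebra `A` is isomorphic to the algebra denoted by `e`. -/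
def Describes (e : BoxEntry) (A : Type) [Ring A] [Algebra ℝ A] : Prop :=
  match e with
  | R N => Nonempty (A ≃ₐ[ℝ] SqMat ℝ N)
  | C N => Nonempty (A ≃ₐ[ℝ] SqMat ℂ N)
  | H N => Nonempty (A ≃ₐ[ℝ] SqMat (Quaternion ℝ) N)
  | RR N => Nonempty (A ≃ₐ[ℝ] SqMat ℝ N × SqMat ℝ N)
  | HH N => Nonempty (A ≃ₐ[ℝ] SqMat (Quaternion ℝ) N × SqMat (Quaternion ℝ) N)

/-- Multiply the matrix size of an entry by `m`. -/
def scale (m : ℕ) : BoxEntry → BoxEntry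
  | R N => R (m * N)
  | C N => C (m * N)
  | H N => H (m * N)
  | RR N => RR (m * N)
  | HH N => HH (m * N)

/-- The classification table; the entry in box `(s, t)`, for `0 ≤ s, t ≤ 8`.
The rows are listed from `t = 0` to `t = 8`, and `s` runs along each row. -/
def table (s t : Fin 9) : BoxEntry :=
  (![![R 1,  RR 1,  R 2,  C 2,  H 2,   HH 2,  H 4,   C 8,   R 16],
     ![C 1,  R 2,   RR 2, R 4,  C 4,   H 4,   HH 4,  H 8,   C 16],
     ![H 1,  C 2,   R 4,  RR 4, R 8,   C 8,   H 8,   HH 8,  H 16],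
     ![HH 1, H 2,   C 4,  R 8,  RR 8,  R 16,  C 16,  H 16,  HH 16],
     ![H 2,  HH 2,  H 4,  C 8,  R 16,  RR 16, R 32,  C 32,  H 32],
     ![C 4,  H 4,   HH 4, H 8,  C 16,  R 32,  RR 32, R 64,  C 64],
     ![R 8,  C 8,   H 8,  HH 8, H 16,  C 32,  R 64,  RR 64, R 128],
     ![RR 8, R 16,  C 16, H 16, HH 16, H 32,  C 64,  R 128, RR 128],
     ![R 16, RR 16, R 32, C 32, H 32,  HH 32, H 64,  C 128, R 256]] : Fin 9 → Fin 9 → BoxEntry) t s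

end BoxEntry

/-! Everything rests on one splitting, `scaledSumEquivTensor`. In the Clifford algebra of `cQ ⊥ ⟨a,
b⟩` the last two basis vectors `i`, `j` generate a quaternion algebra. A vector `m` of `M`
anticommutes with both, hence commutes with `k = ij`, and `k² = -ab = c`. When `c² = 1`, the
elements `c m k` satisfy the relations of `Q` and commute with `i` and `j`, so the algebra is the
tensor product of the two pieces.

Over `ℝ`, the pair `(1, -1)` has `c = 1` and removes one sign of each kind at the cost of a factor
`ℝ[2]`. The pairs `(1, 1)` and `(-1, -1)` have `c = -1`: they interchange `s` and `t` and contribute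
`ℝ[2]` and `ℍ`. Two interchanges cancel, which gives a period-four step with factor `ℍ[2]`; doing it
twice gives `ℍ[2] ⊗ ℍ[2] ≅ ℝ[16]`. The table follows from the algebras of dimension at most one, by
recursion along the axes and then along the diagonals. -/

namespace CliffordAlgebra

/-! ### Splitting off a quaternion algebra -/

section TensorQuaternion

variable {R M : Type*} [CommRing R] [AddCommGroup M] [Module R M]
variable (Q : QuadraticForm R M) (a b c : R)

/-- The orthogonal sum of `c • Q` and the binary form `a x² + b y²`. -/
abbrev scaledSum : QuadraticForm R (M × R × R) :=
  (c • Q).prod (CliffordAlgebraQuaternion.Q a b)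

theorem ι_mul_ι_eq_neg_of_polar {N : Type*} [AddCommGroup N] [Module R N] {P : QuadraticForm R N}
    {x y : N} (h : QuadraticMap.polar P x y = 0) : ι P x * ι P y = -(ι P y * ι P x) := by
  rw [eq_neg_iff_add_eq_zero, ι_mul_ι_add_swap, h, map_zero]

/-- The quaternion basis of `CliffordAlgebra (scaledSum Q a b c)` given by its last two basis
vectors. -/
noncomputable def scaledSumBasis :
    QuaternionAlgebra.Basis (CliffordAlgebra (scaledSum Q a b c)) a 0 b where
  i := ι (scaledSum Q a b c) (0, 1, 0)
  j := ι (scaledSum Q a b c) (0, 0, 1)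
  k := ι (scaledSum Q a b c) (0, 1, 0) * ι (scaledSum Q a b c) (0, 0, 1)
  i_mul_i := by
    rw [ι_sq_scalar, ← Algebra.algebraMap_eq_smul_one]
    simp
  j_mul_j := by
    rw [ι_sq_scalar, ← Algebra.algebraMap_eq_smul_one]
    simp
  i_mul_j := rfl
  j_mul_i := by
    rw [zero_smul, zero_sub]
    exact ι_mul_ι_eq_neg_of_polar (by simp [QuadraticMap.polar])

theorem ι_inl_mul_i (m : M) :
    ι (scaledSum Q a b c) (m, 0) * (scaledSumBasis Q a b c).i =
      -((scaledSumBasis Q a b c).i * ι (scaledSum Q a b c) (m, 0)) :=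
  ι_mul_ι_eq_neg_of_polar (by simp [QuadraticMap.polar])

theorem ι_inl_mul_j (m : M) :
    ι (scaledSum Q a b c) (m, 0) * (scaledSumBasis Q a b c).j =
      -((scaledSumBasis Q a b c).j * ι (scaledSum Q a b c) (m, 0)) :=
  ι_mul_ι_eq_neg_of_polar (by simp [QuadraticMap.polar])

/-- Moving `m` past `i` and then past `j` produces two signs, which cancel. -/
theorem commute_ι_inl_k (m : M) :
    Commute (ι (scaledSum Q a b c) (m, 0)) (scaledSumBasis Q a b c).k := by
  have hi := ι_inl_mul_i Q a b c m
  have hj := ι_inl_mul_j Q a b c m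
  rw [← (scaledSumBasis Q a b c).i_mul_j]
  rw [Commute, SemiconjBy, ← mul_assoc, hi, neg_mul, mul_assoc, hj, mul_neg, neg_neg, mul_assoc]

variable {a b c}

theorem k_mul_k_eq (h : -(a * b) = c) {A : Type*} [Ring A] [Algebra R A]
    (q : QuaternionAlgebra.Basis A a 0 b) : q.k * q.k = algebraMap R A c := by
  rw [q.k_mul_k, ← neg_smul, h, Algebra.algebraMap_eq_smul_one]

/-- Since `m` and `k` commute, the square is `c² m² k²`, with `m² = c Q(m)` and `k² = c`. The
prefactor `c` does not affect the square; it makes the map inverse to `m ↦ m ⊗ k`. -/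
theorem smul_ι_inl_mul_k_mul_self (h : -(a * b) = c) (hc : c * c = 1) (m : M) :
    (c • (ι (scaledSum Q a b c) (m, 0) * (scaledSumBasis Q a b c).k)) *
      (c • (ι (scaledSum Q a b c) (m, 0) * (scaledSumBasis Q a b c).k)) =
      algebraMap R _ (Q m) := by
  rw [smul_mul_smul_comm, hc, one_smul, (commute_ι_inl_k Q a b c m).symm.mul_mul_mul_comm,
    ι_sq_scalar, k_mul_k_eq h, ← map_mul]
  congr 1
  simp only [QuadraticMap.prod_apply, smul_apply, map_zero, add_zero, smul_eq_mul]
  rw [mul_right_comm, hc, one_mul]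

/-- The embedding of `CliffordAlgebra Q` onto the centralizer of the quaternion subalgebra of
`CliffordAlgebra (scaledSum Q a b c)`. -/
noncomputable def toScaledSum (h : -(a * b) = c) (hc : c * c = 1) :
    CliffordAlgebra Q →ₐ[R] CliffordAlgebra (scaledSum Q a b c) :=
  lift Q ⟨c • (LinearMap.mulRight R (scaledSumBasis Q a b c).k) ∘ₗ
    (ι (scaledSum Q a b c)) ∘ₗ LinearMap.inl R M (R × R),
    smul_ι_inl_mul_k_mul_self Q h hc⟩

theorem toScaledSum_ι (h : -(a * b) = c) (hc : c * c = 1) (m : M) :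
    toScaledSum Q h hc (ι Q m) =
      c • (ι (scaledSum Q a b c) (m, 0) * (scaledSumBasis Q a b c).k) :=
  lift_ι_apply _ _ _

/-- On generators, `m` and `k` both anticommute with `i`, so `m k` commutes with it. -/
theorem commute_toScaledSum_i (h : -(a * b) = c) (hc : c * c = 1) (x : CliffordAlgebra Q) :
    Commute (toScaledSum Q h hc x) (scaledSumBasis Q a b c).i := by
  induction x using CliffordAlgebra.induction with
  | algebraMap r => rw [AlgHom.commutes]; exact Algebra.commutes _ _
  | ι m =>
    rw [toScaledSum_ι]
    refine Commute.smul_left ?_ c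
    rw [Commute, SemiconjBy, mul_assoc, QuaternionAlgebra.Basis.k_mul_i, ← mul_assoc,
      ← neg_eq_iff_eq_neg.mpr (ι_inl_mul_i Q a b c m), neg_mul, mul_assoc,
      QuaternionAlgebra.Basis.i_mul_k]
    simp
  | mul x y hx hy => rw [map_mul]; exact hx.mul_left hy
  | add x y hx hy => rw [map_add]; exact hx.add_left hy

theorem commute_toScaledSum_j (h : -(a * b) = c) (hc : c * c = 1) (x : CliffordAlgebra Q) :
    Commute (toScaledSum Q h hc x) (scaledSumBasis Q a b c).j := by
  induction x using CliffordAlgebra.induction with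
  | algebraMap r => rw [AlgHom.commutes]; exact Algebra.commutes _ _
  | ι m =>
    rw [toScaledSum_ι]
    refine Commute.smul_left ?_ c
    rw [Commute, SemiconjBy, mul_assoc, QuaternionAlgebra.Basis.k_mul_j, ← mul_assoc,
      ← neg_eq_iff_eq_neg.mpr (ι_inl_mul_j Q a b c m), neg_mul, mul_assoc,
      QuaternionAlgebra.Basis.j_mul_k]
    simp
  | mul x y hx hy => rw [map_mul]; exact hx.mul_left hy
  | add x y hx hy => rw [map_add]; exact hx.add_left hy

theorem commute_toScaledSum_lift (h : -(a * b) = c) (hc : c * c = 1) (x : CliffordAlgebra Q)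
    (y : QuaternionAlgebra R a 0 b) :
    Commute (toScaledSum Q h hc x) ((scaledSumBasis Q a b c).liftHom y) := by
  have hi := commute_toScaledSum_i Q h hc x
  have hj := commute_toScaledSum_j Q h hc x
  have hk : Commute (toScaledSum Q h hc x) (scaledSumBasis Q a b c).k := by
    rw [← (scaledSumBasis Q a b c).i_mul_j]; exact hi.mul_right hj
  rw [QuaternionAlgebra.Basis.liftHom_apply, QuaternionAlgebra.Basis.lift]
  exact (((Algebra.commute_algebraMap_right _ _).add_right (hi.smul_right _)).add_right
    (hj.smul_right _)).add_right (hk.smul_right _)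

/-- The map `CliffordAlgebra Q ⊗ ℍ[R,a,0,b] → CliffordAlgebra (scaledSum Q a b c)`. -/
noncomputable def tensorToScaledSum (h : -(a * b) = c) (hc : c * c = 1) :
    CliffordAlgebra Q ⊗[R] QuaternionAlgebra R a 0 b →ₐ[R] CliffordAlgebra (scaledSum Q a b c) :=
  Algebra.TensorProduct.lift (toScaledSum Q h hc) (scaledSumBasis Q a b c).liftHom
    (commute_toScaledSum_lift Q h hc)

/-- The pure imaginary quaternion `x i + y j`. -/
def imIJ (a b : R) : R × R →ₗ[R] QuaternionAlgebra R a 0 b where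
  toFun v := ⟨0, v.1, v.2, 0⟩
  map_add' _ _ := by ext <;> simp
  map_smul' _ _ := by ext <;> simp

theorem imIJ_mul_self (v : R × R) :
    imIJ a b v * imIJ a b v = algebraMap R _ (CliffordAlgebraQuaternion.Q a b v) := by
  ext <;> simp [imIJ] <;> ring

theorem k_mul_imIJ (v : R × R) :
    (QuaternionAlgebra.Basis.self R : QuaternionAlgebra.Basis _ a 0 b).k * imIJ a b v =
      -(imIJ a b v * (QuaternionAlgebra.Basis.self R).k) := by
  ext <;> simp [imIJ]

/-- The map `M × R × R → CliffordAlgebra Q ⊗ ℍ[R,a,0,b]` extending to the Clifford algebra of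
`scaledSum Q a b c`. -/
noncomputable def scaledSumVec (a b : R) :
    (M × R × R) →ₗ[R] CliffordAlgebra Q ⊗[R] QuaternionAlgebra R a 0 b :=
  LinearMap.coprod
    ((TensorProduct.mk R (CliffordAlgebra Q) (QuaternionAlgebra R a 0 b)).flip
      (QuaternionAlgebra.Basis.self R).k ∘ₗ ι Q)
    (TensorProduct.mk R (CliffordAlgebra Q) (QuaternionAlgebra R a 0 b) 1 ∘ₗ imIJ a b)

theorem scaledSumVec_apply (m : M) (v : R × R) :
    scaledSumVec Q a b (m, v) =
      ι Q m ⊗ₜ (QuaternionAlgebra.Basis.self R).k + 1 ⊗ₜ imIJ a b v := rfl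

/-- The cross terms cancel because `k` anticommutes with every `x i + y j`; the squares contribute
`c Q(m)` and `a x² + b y²`. -/
theorem scaledSumVec_mul_self (h : -(a * b) = c) (x : M × R × R) :
    scaledSumVec Q a b x * scaledSumVec Q a b x = algebraMap R _ (scaledSum Q a b c x) := by
  obtain ⟨m, v⟩ := x
  rw [scaledSumVec_apply, add_mul, mul_add, mul_add]
  simp only [Algebra.TensorProduct.tmul_mul_tmul, one_mul, mul_one, k_mul_imIJ, imIJ_mul_self,
    ι_sq_scalar, k_mul_k_eq h, TensorProduct.tmul_neg, QuadraticMap.prod_apply, map_add,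
    smul_apply, smul_eq_mul]
  rw [add_assoc, neg_add_cancel_left]
  simp only [Algebra.algebraMap_eq_smul_one, Algebra.TensorProduct.one_def,
    TensorProduct.tmul_smul, TensorProduct.smul_tmul', mul_smul]

/-- The map `CliffordAlgebra (scaledSum Q a b c) → CliffordAlgebra Q ⊗ ℍ[R,a,0,b]`. -/
noncomputable def scaledSumToTensor (h : -(a * b) = c) :
    CliffordAlgebra (scaledSum Q a b c) →ₐ[R] CliffordAlgebra Q ⊗[R] QuaternionAlgebra R a 0 b :=
  lift _ ⟨scaledSumVec Q a b, scaledSumVec_mul_self Q h⟩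

theorem scaledSumToTensor_ι (h : -(a * b) = c) (m : M) (v : R × R) :
    scaledSumToTensor Q h (ι _ (m, v)) =
      ι Q m ⊗ₜ (QuaternionAlgebra.Basis.self R).k + 1 ⊗ₜ imIJ a b v :=
  lift_ι_apply _ _ _

theorem liftHom_imIJ (v : R × R) :
    (scaledSumBasis Q a b c).liftHom (imIJ a b v) = ι (scaledSum Q a b c) (0, v) := by
  have : ((0, v) : M × R × R) = v.1 • (0, 1, 0) + v.2 • (0, 0, 1) := by ext <;> simp
  rw [this, map_add, map_smul, map_smul]
  simp [QuaternionAlgebra.Basis.lift, imIJ]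
  rfl

theorem tensorToScaledSum_comp (h : -(a * b) = c) (hc : c * c = 1) :
    (tensorToScaledSum Q h hc).comp (scaledSumToTensor Q h) = AlgHom.id R _ := by
  refine hom_ext (LinearMap.ext fun x => ?_)
  obtain ⟨m, v⟩ := x
  have hk : (scaledSumBasis Q a b c).liftHom (QuaternionAlgebra.Basis.self R).k =
      (scaledSumBasis Q a b c).k := by simp [QuaternionAlgebra.Basis.lift]
  simp only [LinearMap.comp_apply, AlgHom.toLinearMap_apply, AlgHom.comp_apply, AlgHom.id_apply,
    scaledSumToTensor_ι, map_add, tensorToScaledSum, Algebra.TensorProduct.lift_tmul, map_one,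
    one_mul, liftHom_imIJ, hk, toScaledSum_ι]
  -- On `M` the composite is `m ↦ c (m k) k = c² m = m`.
  rw [smul_mul_assoc, mul_assoc, k_mul_k_eq h, ← Algebra.commutes, ← Algebra.smul_def, smul_smul,
    hc, one_smul, ← map_add]
  simp

theorem scaledSumToTensor_comp (h : -(a * b) = c) (hc : c * c = 1) :
    (scaledSumToTensor Q h).comp (tensorToScaledSum Q h hc) = AlgHom.id R _ := by
  have hi : scaledSumToTensor Q h (scaledSumBasis Q a b c).i =
      1 ⊗ₜ (QuaternionAlgebra.Basis.self R).i := by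
    refine (scaledSumToTensor_ι Q h 0 (1, 0)).trans ?_
    rw [map_zero, TensorProduct.zero_tmul, zero_add]
    rfl
  have hj : scaledSumToTensor Q h (scaledSumBasis Q a b c).j =
      1 ⊗ₜ (QuaternionAlgebra.Basis.self R).j := by
    refine (scaledSumToTensor_ι Q h 0 (0, 1)).trans ?_
    rw [map_zero, TensorProduct.zero_tmul, zero_add]
    rfl
  have hk : scaledSumToTensor Q h (scaledSumBasis Q a b c).k =
      1 ⊗ₜ (QuaternionAlgebra.Basis.self R).k := by
    rw [← (scaledSumBasis Q a b c).i_mul_j, map_mul, hi, hj, Algebra.TensorProduct.tmul_mul_tmul,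
      one_mul, QuaternionAlgebra.Basis.i_mul_j]
  -- It suffices to compare on vectors of `M` in the left factor and on `i`, `j` in the right one.
  refine Algebra.TensorProduct.ext (hom_ext (LinearMap.ext fun m => ?_))
    (QuaternionAlgebra.hom_ext ?_ ?_)
  · simp only [LinearMap.comp_apply, AlgHom.toLinearMap_apply, AlgHom.comp_apply, AlgHom.id_apply,
      Algebra.TensorProduct.includeLeft_apply, tensorToScaledSum,
      Algebra.TensorProduct.lift_tmul, map_one, mul_one, toScaledSum_ι, map_smul, map_mul, hk,
      scaledSumToTensor_ι, map_zero, TensorProduct.tmul_zero, add_zero,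
      Algebra.TensorProduct.tmul_mul_tmul, k_mul_k_eq h]
    rw [Algebra.algebraMap_eq_smul_one, TensorProduct.tmul_smul, smul_smul, hc, one_smul]
  · simpa [tensorToScaledSum, QuaternionAlgebra.Basis.lift] using hi
  · simpa [tensorToScaledSum, QuaternionAlgebra.Basis.lift] using hj

/-- If `c = -ab` squares to `1`, the Clifford algebra of `cQ ⊥ ⟨a, b⟩` is the tensor product of
that of `Q` with the quaternion algebra `ℍ[R,a,0,b]`. -/
noncomputable def scaledSumEquivTensor (h : -(a * b) = c) (hc : c * c = 1) :
    CliffordAlgebra (scaledSum Q a b c) ≃ₐ[R]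
      CliffordAlgebra Q ⊗[R] QuaternionAlgebra R a 0 b :=
  AlgEquiv.ofAlgHom (scaledSumToTensor Q h) (tensorToScaledSum Q h hc)
    (scaledSumToTensor_comp Q h hc) (tensorToScaledSum_comp Q h hc)

end TensorQuaternion

end CliffordAlgebra

/-! ### Decomposing the standard forms; even subalgebras -/

section Signature

open CliffordAlgebra

theorem signatureForm_apply (s t : ℕ) (x : Fin s ⊕ Fin t → ℝ) :
    signatureForm s t x =
      ∑ i, x (Sum.inl i) * x (Sum.inl i) - ∑ j, x (Sum.inr j) * x (Sum.inr j) := by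
  simp [signatureForm, QuadraticMap.weightedSumSquares_apply, sub_eq_add_neg]

/-- `ℝ^{s+1,t}` is the orthogonal sum of `ℝ^{s,t}` and a positive line. -/
noncomputable def signatureFormSuccLeft (s t : ℕ) :
    (signatureForm (s + 1) t).IsometryEquiv
      ((signatureForm s t).prod (QuadraticMap.sq (R := ℝ))) where
  toFun x := (Sum.elim (fun i => x (Sum.inl i.succ)) (fun j => x (Sum.inr j)), x (Sum.inl 0))
  invFun y := Sum.elim (Fin.cons y.2 fun i => y.1 (Sum.inl i)) fun j => y.1 (Sum.inr j)
  map_add' _ _ := by ext i <;> [cases i; skip] <;> rfl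
  map_smul' _ _ := by ext i <;> [cases i; skip] <;> rfl
  left_inv x := by
    ext (i | j)
    · cases i using Fin.cases <;> rfl
    · rfl
  right_inv y := by ext i <;> [cases i; skip] <;> rfl
  map_app' x := by
    simp [signatureForm_apply, Fin.sum_univ_succ]
    ring

/-- `ℝ^{s,t}` is `ℝ^{t,s}` with the opposite quadratic form. -/
noncomputable def signatureFormSwap (s t : ℕ) :
    (signatureForm s t).IsometryEquiv (-signatureForm t s) where
  __ := LinearEquiv.funCongrLeft ℝ ℝ (Equiv.sumComm (Fin t) (Fin s))
  map_app' x := by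
    simp [signatureForm_apply, LinearMap.funLeft]

/-- `ℝ^{s,t+1}` is the orthogonal sum of `ℝ^{s,t}` and a negative line. -/
noncomputable def signatureFormSuccRight (s t : ℕ) :
    (signatureForm s (t + 1)).IsometryEquiv
      ((signatureForm s t).prod (-QuadraticMap.sq (R := ℝ))) where
  toFun x := (Sum.elim (fun i => x (Sum.inl i)) (fun j => x (Sum.inr j.succ)), x (Sum.inr 0))
  invFun y := Sum.elim (fun i => y.1 (Sum.inl i)) (Fin.cons y.2 fun j => y.1 (Sum.inr j))
  map_add' _ _ := by ext i <;> [cases i; skip] <;> rfl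
  map_smul' _ _ := by ext i <;> [cases i; skip] <;> rfl
  left_inv x := by
    ext (i | j)
    · rfl
    · cases j using Fin.cases <;> rfl
  right_inv y := by ext i <;> [cases i; skip] <;> rfl
  map_app' x := by
    simp [signatureForm_apply, Fin.sum_univ_succ]
    ring

theorem signatureForm_add_one_add_one_equivalent (s t : ℕ) :
    (signatureForm (s + 1) (t + 1)).Equivalent (scaledSum (signatureForm s t) 1 (-1) 1) := by
  refine ⟨(signatureFormSuccRight (s + 1) t).trans
    (((signatureFormSuccLeft s t).prod (.refl _)).trans
      ⟨LinearEquiv.prodAssoc ℝ _ _ _, fun x => ?_⟩)⟩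
  simp
  ring

/-- Here `c = -1`, so the remaining form must appear as the negative of another one; this is why `s`
and `t` trade places. -/
theorem signatureForm_add_two_left_equivalent (s t : ℕ) :
    (signatureForm (s + 2) t).Equivalent (scaledSum (signatureForm t s) 1 1 (-1)) := by
  refine ⟨(signatureFormSuccLeft (s + 1) t).trans
    (((signatureFormSuccLeft s t).prod (.refl _)).trans
      ((((signatureFormSwap s t).prod (.refl _)).prod (.refl _)).trans
      ⟨LinearEquiv.prodAssoc ℝ _ _ _, fun x => ?_⟩))⟩
  simp
  ring

theorem signatureForm_add_two_right_equivalent (s t : ℕ) :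
    (signatureForm s (t + 2)).Equivalent (scaledSum (signatureForm t s) (-1) (-1) (-1)) := by
  refine ⟨(signatureFormSuccRight s (t + 1)).trans
    (((signatureFormSuccRight s t).prod (.refl _)).trans
      ((((signatureFormSwap s t).prod (.refl _)).prod (.refl _)).trans
      ⟨LinearEquiv.prodAssoc ℝ _ _ _, fun x => ?_⟩))⟩
  simp
  ring

/-- Multiplying coordinates by `Complex.I` negates the sum of squares, so over `ℂ` the sign `c = -1`
is absorbed. -/
theorem complexForm_add_two_equivalent (n : ℕ) :
    (complexForm (n + 2)).Equivalent (scaledSum (complexForm n) 1 1 (-1)) := by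
  let e : (Fin (n + 2) → ℂ) ≃ₗ[ℂ] ((Fin n → ℂ) × ℂ × ℂ) :=
    { toFun x := (fun i => Complex.I * x i.succ.succ, x 0, x 1)
      invFun y := Fin.cons y.2.1 (Fin.cons y.2.2 fun i => -Complex.I * y.1 i)
      map_add' x y := by ext <;> simp [mul_add]
      map_smul' r x := by ext <;> simp [mul_left_comm]
      left_inv x := by
        ext i
        cases i using Fin.cases with
        | zero => rfl
        | succ i =>
          cases i using Fin.cases with
          | zero => rfl
          | succ i => simp [← mul_assoc]
      right_inv y := by
        ext <;> simp [← mul_assoc] }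
  refine ⟨⟨e, fun x => ?_⟩⟩
  simp [e, complexForm, QuadraticMap.weightedSumSquares_apply, Fin.sum_univ_succ,
    mul_mul_mul_comm Complex.I]
  ring

/-- Isometric forms have isomorphic Clifford algebras, so a form isometric to a `scaledSum` has a
tensor product decomposition. -/
theorem nonempty_cliffordAlgebra_equiv_tensor {R M N : Type*} [CommRing R] [AddCommGroup M]
    [Module R M] [AddCommGroup N] [Module R N] {P : QuadraticForm R N} {Q : QuadraticForm R M}
    {a b c : R} (e : P.Equivalent (scaledSum Q a b c)) (h : -(a * b) = c) (hc : c * c = 1) :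
    Nonempty (CliffordAlgebra P ≃ₐ[R] CliffordAlgebra Q ⊗[R] QuaternionAlgebra R a 0 b) :=
  e.map fun e => (equivOfIsometry e).trans (scaledSumEquivTensor Q h hc)

theorem realGeomAlg_add_one_add_one (s t : ℕ) : Nonempty (RealGeomAlg (s + 1) (t + 1) ≃ₐ[ℝ]
    RealGeomAlg s t ⊗[ℝ] QuaternionAlgebra ℝ 1 0 (-1)) :=
  nonempty_cliffordAlgebra_equiv_tensor (signatureForm_add_one_add_one_equivalent s t)
    (by norm_num) (by norm_num)

theorem realGeomAlg_add_two_left (s t : ℕ) : Nonempty (RealGeomAlg (s + 2) t ≃ₐ[ℝ]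
    RealGeomAlg t s ⊗[ℝ] QuaternionAlgebra ℝ 1 0 1) :=
  nonempty_cliffordAlgebra_equiv_tensor (signatureForm_add_two_left_equivalent s t)
    (by norm_num) (by norm_num)

theorem realGeomAlg_add_two_right (s t : ℕ) : Nonempty (RealGeomAlg s (t + 2) ≃ₐ[ℝ]
    RealGeomAlg t s ⊗[ℝ] Quaternion ℝ) :=
  nonempty_cliffordAlgebra_equiv_tensor (signatureForm_add_two_right_equivalent s t)
    (by norm_num) (by norm_num)

theorem complexGeomAlg_add_two (n : ℕ) : Nonempty (ComplexGeomAlg (n + 2) ≃ₐ[ℂ]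
    ComplexGeomAlg n ⊗[ℂ] QuaternionAlgebra ℂ 1 0 1) :=
  nonempty_cliffordAlgebra_equiv_tensor (complexForm_add_two_equivalent n)
    (by norm_num) (by norm_num)

/-- The Clifford algebra of a form on a trivial module. -/
theorem nonempty_cliffordAlgebra_equiv_of_subsingleton {R M : Type*} [CommRing R] [AddCommGroup M]
    [Module R M] [Subsingleton M] (Q : QuadraticForm R M) : Nonempty (CliffordAlgebra Q ≃ₐ[R] R) :=
  ⟨AlgEquiv.ofAlgHom
    (lift Q ⟨0, fun m => by simp [Subsingleton.elim m 0]⟩) (Algebra.ofId R _)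
    (by ext) (hom_ext (LinearMap.ext fun m => by simp [Subsingleton.elim m 0]))⟩

/-- The map of even Clifford subalgebras induced by an isometry. -/
noncomputable def evenMap {R M N : Type*} [CommRing R] [AddCommGroup M]
    [Module R M] [AddCommGroup N] [Module R N] {P : QuadraticForm R N} {Q : QuadraticForm R M}
    (f : P →qᵢ Q) : even P →ₐ[R] even Q :=
  even.lift P
    { bilin := (even.ι Q).bilin.compl₁₂ f.toLinearMap f.toLinearMap
      contract := fun m => by
        simpa using (even.ι Q).contract (f m)
      contract_mid := fun m₁ m₂ m₃ => by
        simpa using (even.ι Q).contract_mid (f m₁) (f m₂) (f m₃) }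

theorem evenMap_ι {R M N : Type*} [CommRing R] [AddCommGroup M]
    [Module R M] [AddCommGroup N] [Module R N] {P : QuadraticForm R N} {Q : QuadraticForm R M}
    (f : P →qᵢ Q) (m₁ m₂ : N) :
    evenMap f ((even.ι P).bilin m₁ m₂) = (even.ι Q).bilin (f m₁) (f m₂) :=
  even.lift_ι _ _ _ _

/-- Isometric forms have isomorphic even Clifford subalgebras. -/
noncomputable def evenEquivOfIsometry {R M N : Type*} [CommRing R] [AddCommGroup M]
    [Module R M] [AddCommGroup N] [Module R N] {P : QuadraticForm R N} {Q : QuadraticForm R M}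
    (e : P.IsometryEquiv Q) : even P ≃ₐ[R] even Q :=
  AlgEquiv.ofAlgHom (evenMap e.toIsometry) (evenMap e.symm.toIsometry)
    (even.algHom_ext _ <| EvenHom.ext <| LinearMap.ext₂ fun m₁ m₂ => by simp [evenMap_ι])
    (even.algHom_ext _ <| EvenHom.ext <| LinearMap.ext₂ fun m₁ m₂ => by simp [evenMap_ι])

/-- With `e² = -1` and `e` orthogonal to `v`, the even element `e v` has square `v²`; `equivEven` is
the resulting isomorphism. -/
theorem realGeomAlgEven_succ_right (s t : ℕ) :
    Nonempty (RealGeomAlgEven s (t + 1) ≃ₐ[ℝ] RealGeomAlg s t) :=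
  ⟨(evenEquivOfIsometry (signatureFormSuccRight s t)).trans (equivEven _).symm⟩

/-- Negating all products of two vectors turns the even relations of a form into those of its
opposite. -/
theorem realGeomAlgEven_swap (s t : ℕ) :
    Nonempty (RealGeomAlgEven s t ≃ₐ[ℝ] RealGeomAlgEven t s) :=
  ⟨(evenEquivOfIsometry (signatureFormSwap s t)).trans (evenEquivEvenNeg _).symm⟩

end Signature

/-! ### Matrix algebras and their tensor products -/

section MatrixAlgebras

/-- If `c² = 1`, the quaternion algebra `ℍ[ℝ,1,0,c]` is split. -/
noncomputable def splitQuaternionEquiv (c : ℝ) (hc : c * c = 1) :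
    QuaternionAlgebra ℝ 1 0 c ≃ₐ[ℝ] SqMat ℝ 2 :=
  AlgEquiv.ofLinearEquiv
    -- This sends `i` to `diag(1, -1)` and `j` to `!![0, 1; c, 0]`. The inverse uses `c⁻¹ = c`.
    { toFun q := !![q.re + q.imI, q.imJ + q.imK; c * (q.imJ - q.imK), q.re - q.imI]
      invFun m := ⟨(m 0 0 + m 1 1) / 2, (m 0 0 - m 1 1) / 2, (m 0 1 + c * m 1 0) / 2,
        (m 0 1 - c * m 1 0) / 2⟩
      map_add' p q := by
        ext i j
        fin_cases i <;> fin_cases j <;> simp <;> ring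
      map_smul' r q := by
        ext i j
        fin_cases i <;> fin_cases j <;> simp <;> ring
      left_inv q := by
        ext <;> simp [← mul_assoc, hc]
      right_inv m := by
        ext i j
        fin_cases i <;> fin_cases j <;> simp <;>
          first | ring1 | linear_combination (m 1 0) * hc }
    (by
      ext i j
      fin_cases i <;> fin_cases j <;> simp)
    (fun p q => by
      ext i j
      fin_cases i <;> fin_cases j <;> simp [Matrix.mul_apply, Fin.sum_univ_two] <;> ring)

variable {A B F G : Type} [Ring A] [Algebra ℝ A] [Ring B] [Algebra ℝ B]
  [Ring F] [Algebra ℝ F] [Ring G] [Algebra ℝ G]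

/-- Interchange of the last two factors of a triple tensor product of algebras. -/
noncomputable def tensorRightComm : (A ⊗[ℝ] B) ⊗[ℝ] F ≃ₐ[ℝ] (A ⊗[ℝ] F) ⊗[ℝ] B :=
  (Algebra.TensorProduct.assoc ℝ ℝ ℝ A B F).trans <|
    (Algebra.TensorProduct.congr .refl (Algebra.TensorProduct.comm ℝ B F)).trans
      (Algebra.TensorProduct.assoc ℝ ℝ ℝ A F B).symm

/-- `F[N] ⊗ B ≅ G[kN]` whenever `F ⊗ B ≅ G[k]`. -/
noncomputable def sqMatTensorEquiv (N k : ℕ) (e : F ⊗[ℝ] B ≃ₐ[ℝ] SqMat G k) :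
    SqMat F N ⊗[ℝ] B ≃ₐ[ℝ] SqMat G (k * N) :=
  ((((Algebra.TensorProduct.congr (matrixEquivTensor (Fin N) ℝ F) AlgEquiv.refl).trans
    (tensorRightComm)).trans
    (matrixEquivTensor (Fin N) ℝ (F ⊗[ℝ] B)).symm).trans e.mapMatrix).trans
    ((Matrix.compAlgEquiv (Fin N) (Fin k) G ℝ).trans
      -- Exchanging the two indices makes the size `k * N` instead of `N * k`, in agreement with
      -- `BoxEntry.scale`.
      (Matrix.reindexAlgEquiv ℝ G ((Equiv.prodComm _ _).trans finProdFinEquiv)))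

/-- Tensor products distribute over products on the left. -/
noncomputable def prodTensorEquiv : (A × B) ⊗[ℝ] F ≃ₐ[ℝ] (A ⊗[ℝ] F) × (B ⊗[ℝ] F) :=
  ((Algebra.TensorProduct.comm ℝ _ _).trans (Algebra.TensorProduct.prodRight ℝ ℝ F A B)).trans
    (AlgEquiv.prodCongr (Algebra.TensorProduct.comm ℝ _ _) (Algebra.TensorProduct.comm ℝ _ _))

/-- A ring is the algebra of `1 × 1` matrices over itself. -/
noncomputable def sqMatOneEquiv : A ≃ₐ[ℝ] SqMat A 1 where
  toFun a := Matrix.of fun _ _ => a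
  invFun m := m 0 0
  left_inv _ := rfl
  right_inv m := by
    ext i j
    rw [Subsingleton.elim i 0, Subsingleton.elim j 0]
    rfl
  map_mul' a b := by
    ext
    simp [Matrix.mul_apply]
  map_add' _ _ := rfl
  commutes' r := by
    ext i j
    rw [Subsingleton.elim i 0, Subsingleton.elim j 0]
    simp [Matrix.algebraMap_matrix_apply]

end MatrixAlgebras

/-! ### Low-dimensional algebras and tensor products of `ℂ` and `ℍ` -/

section LowDimension

open CliffordAlgebra

theorem realGeomAlg_zero_zero : Nonempty (RealGeomAlg 0 0 ≃ₐ[ℝ] ℝ) :=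
  nonempty_cliffordAlgebra_equiv_of_subsingleton _

/-- The orthogonal sum with a form on a trivial space. -/
noncomputable def subsingletonProdIsometryEquiv {R M N : Type*} [CommRing R] [AddCommGroup M]
    [Module R M] [AddCommGroup N] [Module R N] [Unique M] (P : QuadraticForm R M)
    (Q : QuadraticForm R N) : (P.prod Q).IsometryEquiv Q where
  __ := LinearEquiv.uniqueProd
  map_app' x := by
    simp [Subsingleton.elim x.1 0]

theorem realGeomAlg_zero_one : Nonempty (RealGeomAlg 0 1 ≃ₐ[ℝ] ℂ) :=
  ⟨(equivOfIsometry ((signatureFormSuccRight 0 0).trans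
    (subsingletonProdIsometryEquiv _ _))).trans CliffordAlgebraComplex.equiv⟩

/-- The map from the Clifford algebra of the form `x²` on `ℝ` sending the unit vector to
`(1, -1)`. -/
noncomputable def cliffordAlgebraSqToProd :
    CliffordAlgebra (QuadraticMap.sq (R := ℝ)) →ₐ[ℝ] ℝ × ℝ :=
  lift (QuadraticMap.sq (R := ℝ)) ⟨LinearMap.prod LinearMap.id (-LinearMap.id),
    fun m => by ext <;> simp⟩

theorem cliffordAlgebraSqToProd_ι (r : ℝ) :
    cliffordAlgebraSqToProd (ι (QuadraticMap.sq (R := ℝ)) r) = (r, -r) :=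
  lift_ι_apply _ _ _

/-- The Clifford algebra of the form `x²` on `ℝ` is `ℝ ⊕ ℝ`. -/
noncomputable def cliffordAlgebraSqEquiv :
    CliffordAlgebra (QuadraticMap.sq (R := ℝ)) ≃ₐ[ℝ] ℝ × ℝ :=
  have he : ι (QuadraticMap.sq (R := ℝ)) 1 * ι (QuadraticMap.sq (R := ℝ)) 1 = 1 := by
    rw [ι_sq_scalar]; simp
  AlgEquiv.ofAlgHom
    cliffordAlgebraSqToProd
    -- With `e² = 1`, the orthogonal idempotents `(1 ± e) / 2` are the images of `(1, 0)` and `(0,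
    -- 1)`.
    (AlgHom.ofLinearMap
      ((LinearMap.toSpanSingleton ℝ _ ((2⁻¹ : ℝ) • (1 + ι (QuadraticMap.sq (R := ℝ)) 1))).coprod
        (LinearMap.toSpanSingleton ℝ _ ((2⁻¹ : ℝ) • (1 - ι (QuadraticMap.sq (R := ℝ)) 1))))
      (by
        simp only [LinearMap.coprod_apply, LinearMap.toSpanSingleton_apply, Prod.fst_one,
          Prod.snd_one]
        module)
      (fun x y => by
        simp only [LinearMap.coprod_apply, LinearMap.toSpanSingleton_apply, Prod.fst_mul,
          Prod.snd_mul, add_mul, mul_add, sub_mul, mul_sub, smul_mul_smul_comm, mul_one, one_mul,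
          smul_add, smul_sub, he]
        module))
    (AlgHom.ext fun x => by
      ext <;> simp [cliffordAlgebraSqToProd_ι] <;> ring)
    (hom_ext (LinearMap.ext_ring (by
      simp [cliffordAlgebraSqToProd_ι]
      module)))

theorem realGeomAlg_one_zero : Nonempty (RealGeomAlg 1 0 ≃ₐ[ℝ] ℝ × ℝ) :=
  ⟨(equivOfIsometry ((signatureFormSuccLeft 0 0).trans
    (subsingletonProdIsometryEquiv _ _))).trans cliffordAlgebraSqEquiv⟩

theorem realGeomAlg_hyperbolic (s t : ℕ) :
    Nonempty (RealGeomAlg (s + 1) (t + 1) ≃ₐ[ℝ] RealGeomAlg s t ⊗[ℝ] SqMat ℝ 2) :=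
  (realGeomAlg_add_one_add_one s t).map fun e => e.trans
    (Algebra.TensorProduct.congr .refl (splitQuaternionEquiv (-1) (by norm_num)))

theorem realGeomAlg_add_two_left_matrix (s t : ℕ) :
    Nonempty (RealGeomAlg (s + 2) t ≃ₐ[ℝ] RealGeomAlg t s ⊗[ℝ] SqMat ℝ 2) :=
  (realGeomAlg_add_two_left s t).map fun e => e.trans
    (Algebra.TensorProduct.congr .refl (splitQuaternionEquiv 1 (by norm_num)))

theorem realGeomAlg_one_one : Nonempty (RealGeomAlg 1 1 ≃ₐ[ℝ] SqMat ℝ 2) := by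
  obtain ⟨e⟩ := realGeomAlg_hyperbolic 0 0
  obtain ⟨f⟩ := realGeomAlg_zero_zero
  exact ⟨(e.trans (Algebra.TensorProduct.congr f .refl)).trans (Algebra.TensorProduct.lid ℝ _)⟩

theorem realGeomAlg_two_zero : Nonempty (RealGeomAlg 2 0 ≃ₐ[ℝ] SqMat ℝ 2) := by
  obtain ⟨e⟩ := realGeomAlg_add_two_left_matrix 0 0
  obtain ⟨f⟩ := realGeomAlg_zero_zero
  exact ⟨(e.trans (Algebra.TensorProduct.congr f .refl)).trans (Algebra.TensorProduct.lid ℝ _)⟩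

theorem realGeomAlg_zero_two : Nonempty (RealGeomAlg 0 2 ≃ₐ[ℝ] Quaternion ℝ) := by
  obtain ⟨e⟩ := realGeomAlg_add_two_right 0 0
  obtain ⟨f⟩ := realGeomAlg_zero_zero
  exact ⟨(e.trans (Algebra.TensorProduct.congr f .refl)).trans (Algebra.TensorProduct.lid ℝ _)⟩

theorem complexGeomAlg_two : Nonempty (ComplexGeomAlg 2 ≃ₐ[ℂ] QuaternionAlgebra ℂ 1 0 1) := by
  obtain ⟨e⟩ := complexGeomAlg_add_two 0
  obtain ⟨f⟩ := nonempty_cliffordAlgebra_equiv_of_subsingleton (complexForm 0)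
  exact ⟨(e.trans (Algebra.TensorProduct.congr f .refl)).trans (Algebra.TensorProduct.lid ℂ _)⟩

theorem complex_tensor_complex : Nonempty (ℂ ⊗[ℝ] ℂ ≃ₐ[ℝ] ℂ × ℂ) := by
  let f : ℂ ⊗[ℝ] ℂ →ₐ[ℝ] ℂ × ℂ := Algebra.TensorProduct.lift
    ((AlgHom.id ℝ ℂ).prod (AlgHom.id ℝ ℂ))
    ((AlgHom.id ℝ ℂ).prod Complex.conjAe.toAlgHom) fun _ _ => Commute.all _ _
  have hs : Function.Surjective f := fun x =>
    -- Since `f (z ⊗ w) = (z w, z w̄)`, the idempotents `(1 ⊗ 1 ∓ I ⊗ I) / 2` map to `(1, 0)` and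
    -- `(0, 1)`; the witness is their combination with coefficients `x.1`, `x.2`.
    ⟨((x.1 + x.2) / 2) ⊗ₜ 1 + (((x.2 - x.1) / 2) * Complex.I) ⊗ₜ Complex.I, by
      ext1 <;> simp [f, mul_assoc] <;> ring⟩
  refine ⟨AlgEquiv.ofBijective f ⟨?_, hs⟩⟩
  exact (LinearMap.injective_iff_surjective_of_finrank_eq_finrank (f := f.toLinearMap)
    (by simp)).mpr hs

/-- Both sides are `𝒢(ℝ^{1,2})`: split off the negative pair for `ℂ ⊗ ℍ`, or a hyperbolic plane for
`ℂ ⊗ ℝ[2]`. -/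
theorem complex_tensor_quaternion : Nonempty (ℂ ⊗[ℝ] Quaternion ℝ ≃ₐ[ℝ] SqMat ℂ 2) := by
  obtain ⟨e⟩ := realGeomAlg_add_two_right 1 0
  obtain ⟨f⟩ := realGeomAlg_hyperbolic 0 1
  obtain ⟨g⟩ := realGeomAlg_zero_one
  exact ⟨(Algebra.TensorProduct.congr g.symm .refl).trans <| e.symm.trans <| f.trans <|
    (Algebra.TensorProduct.congr g .refl).trans (matrixEquivTensor (Fin 2) ℝ ℂ).symm⟩

/-- Both sides are `𝒢(ℝ^{2,2})`: splitting off the negative pair gives `ℍ ⊗ ℍ`, a hyperbolic plane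
gives `ℝ[2] ⊗ ℝ[2]`. -/
theorem quaternion_tensor_quaternion :
    Nonempty (Quaternion ℝ ⊗[ℝ] Quaternion ℝ ≃ₐ[ℝ] SqMat ℝ 4) := by
  obtain ⟨e⟩ := realGeomAlg_add_two_right 2 0
  obtain ⟨f⟩ := realGeomAlg_hyperbolic 1 1
  obtain ⟨g⟩ := realGeomAlg_zero_two
  obtain ⟨k⟩ := realGeomAlg_one_one
  exact ⟨(Algebra.TensorProduct.congr g.symm .refl).trans <| e.symm.trans <| f.trans <|
    (Algebra.TensorProduct.congr k .refl).trans
      (sqMatTensorEquiv 2 2 (Algebra.TensorProduct.lid ℝ _))⟩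

end LowDimension

/-! ### Periodicity modulo eight -/

section Periodicity

/-- `ℍ[2] ⊗ ℍ[2] ≅ ℝ[16]`. -/
theorem quaternionMatrix_tensor_self : Nonempty
    (SqMat (Quaternion ℝ) 2 ⊗[ℝ] SqMat (Quaternion ℝ) 2 ≃ₐ[ℝ] SqMat ℝ 16) := by
  obtain ⟨e⟩ := quaternion_tensor_quaternion
  -- The inner step gives `ℍ ⊗ ℍ[2] ≅ ℝ[8]`; the outer one enlarges it to size `8 * 2`.
  exact ⟨sqMatTensorEquiv 2 8 ((Algebra.TensorProduct.comm ℝ _ _).trans (sqMatTensorEquiv 2 4 e))⟩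

/-- Two positive vectors contribute `ℝ[2]` and turn the other two into negative ones, which
contribute `ℍ` and restore the original order of `s` and `t`. -/
theorem realGeomAlg_add_four_left (s t : ℕ) : Nonempty
    (RealGeomAlg (s + 4) t ≃ₐ[ℝ] RealGeomAlg s t ⊗[ℝ] SqMat (Quaternion ℝ) 2) := by
  obtain ⟨e⟩ := realGeomAlg_add_two_left_matrix (s + 2) t
  obtain ⟨f⟩ := realGeomAlg_add_two_right t s
  exact ⟨e.trans <| (Algebra.TensorProduct.congr f .refl).trans <|
    (Algebra.TensorProduct.assoc ℝ ℝ ℝ _ _ _).trans <|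
    Algebra.TensorProduct.congr .refl (matrixEquivTensor (Fin 2) ℝ (Quaternion ℝ)).symm⟩

theorem realGeomAlg_add_four_right (s t : ℕ) : Nonempty
    (RealGeomAlg s (t + 4) ≃ₐ[ℝ] RealGeomAlg s t ⊗[ℝ] SqMat (Quaternion ℝ) 2) := by
  obtain ⟨e⟩ := realGeomAlg_add_two_right s (t + 2)
  obtain ⟨f⟩ := realGeomAlg_add_two_left_matrix t s
  exact ⟨e.trans <| (Algebra.TensorProduct.congr f .refl).trans <|
    (tensorRightComm).trans <|
    (Algebra.TensorProduct.assoc ℝ ℝ ℝ _ _ _).trans <|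
    Algebra.TensorProduct.congr .refl (matrixEquivTensor (Fin 2) ℝ (Quaternion ℝ)).symm⟩

theorem realGeomAlg_add_eight_left (s t : ℕ) : Nonempty
    (RealGeomAlg (s + 8) t ≃ₐ[ℝ] RealGeomAlg s t ⊗[ℝ] SqMat ℝ 16) := by
  obtain ⟨e⟩ := realGeomAlg_add_four_left (s + 4) t
  obtain ⟨f⟩ := realGeomAlg_add_four_left s t
  obtain ⟨g⟩ := quaternionMatrix_tensor_self
  exact ⟨e.trans <| (Algebra.TensorProduct.congr f .refl).trans <|
    (Algebra.TensorProduct.assoc ℝ ℝ ℝ _ _ _).trans <| Algebra.TensorProduct.congr .refl g⟩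

theorem realGeomAlg_add_eight_right (s t : ℕ) : Nonempty
    (RealGeomAlg s (t + 8) ≃ₐ[ℝ] RealGeomAlg s t ⊗[ℝ] SqMat ℝ 16) := by
  obtain ⟨e⟩ := realGeomAlg_add_four_right s (t + 4)
  obtain ⟨f⟩ := realGeomAlg_add_four_right s t
  obtain ⟨g⟩ := quaternionMatrix_tensor_self
  exact ⟨e.trans <| (Algebra.TensorProduct.congr f .refl).trans <|
    (Algebra.TensorProduct.assoc ℝ ℝ ℝ _ _ _).trans <| Algebra.TensorProduct.congr .refl g⟩

theorem realGeomAlg_eight_zero : Nonempty (RealGeomAlg 8 0 ≃ₐ[ℝ] SqMat ℝ 16) := by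
  obtain ⟨e⟩ := realGeomAlg_add_eight_left 0 0
  obtain ⟨f⟩ := realGeomAlg_zero_zero
  exact ⟨(e.trans (Algebra.TensorProduct.congr f .refl)).trans (Algebra.TensorProduct.lid ℝ _)⟩

theorem realGeomAlg_zero_eight : Nonempty (RealGeomAlg 0 8 ≃ₐ[ℝ] SqMat ℝ 16) := by
  obtain ⟨e⟩ := realGeomAlg_add_eight_right 0 0
  obtain ⟨f⟩ := realGeomAlg_zero_zero
  exact ⟨(e.trans (Algebra.TensorProduct.congr f .refl)).trans (Algebra.TensorProduct.lid ℝ _)⟩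

end Periodicity

/-! ### Verifying the table -/

namespace BoxEntry

variable {A B : Type} [Ring A] [Algebra ℝ A] [Ring B] [Algebra ℝ B]

theorem Describes.congr {d : BoxEntry} (h : d.Describes A) (e : B ≃ₐ[ℝ] A) : d.Describes B := by
  cases d <;> exact h.map fun f => e.trans f

theorem Describes.scale {d : BoxEntry} (h : d.Describes A) (m : ℕ) :
    (d.scale m).Describes (A ⊗[ℝ] SqMat ℝ m) := by
  cases d with
  | R N | C N | H N =>
    exact h.map fun f => (Algebra.TensorProduct.congr f .refl).trans
      (sqMatTensorEquiv N m (matrixEquivTensor (Fin m) ℝ _).symm)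
  | RR N | HH N =>
    exact h.map fun f => ((Algebra.TensorProduct.congr f .refl).trans prodTensorEquiv).trans
      (AlgEquiv.prodCongr (sqMatTensorEquiv N m (matrixEquivTensor (Fin m) ℝ _).symm)
        (sqMatTensorEquiv N m (matrixEquivTensor (Fin m) ℝ _).symm))

/-- The entry of the tensor product with `ℍ`. -/
def tensorQuaternion : BoxEntry → BoxEntry
  -- Sizes stay in the form `k * N` produced by `sqMatTensorEquiv`, where `F ⊗ ℍ ≅ G[k]`.
  | R N => H (1 * N)
  | C N => C (2 * N)
  | H N => R (4 * N)
  | RR N => HH (1 * N)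
  | HH N => RR (4 * N)

theorem Describes.tensorQuaternion {d : BoxEntry} (h : d.Describes A) :
    d.tensorQuaternion.Describes (A ⊗[ℝ] Quaternion ℝ) := by
  have eR : ℝ ⊗[ℝ] Quaternion ℝ ≃ₐ[ℝ] SqMat (Quaternion ℝ) 1 :=
    (Algebra.TensorProduct.lid ℝ _).trans sqMatOneEquiv
  obtain ⟨eC⟩ := complex_tensor_quaternion
  obtain ⟨eH⟩ := quaternion_tensor_quaternion
  cases d with
  | R N => exact h.map fun f => (Algebra.TensorProduct.congr f .refl).trans (sqMatTensorEquiv N 1 eR)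
  | C N => exact h.map fun f => (Algebra.TensorProduct.congr f .refl).trans (sqMatTensorEquiv N 2 eC)
  | H N => exact h.map fun f => (Algebra.TensorProduct.congr f .refl).trans (sqMatTensorEquiv N 4 eH)
  | RR N =>
    exact h.map fun f => ((Algebra.TensorProduct.congr f .refl).trans prodTensorEquiv).trans
      (AlgEquiv.prodCongr (sqMatTensorEquiv N 1 eR) (sqMatTensorEquiv N 1 eR))
  | HH N =>
    exact h.map fun f => ((Algebra.TensorProduct.congr f .refl).trans prodTensorEquiv).trans
      (AlgEquiv.prodCongr (sqMatTensorEquiv N 4 eH) (sqMatTensorEquiv N 4 eH))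

theorem scale_one (d : BoxEntry) : d.scale 1 = d := by
  cases d <;> simp [BoxEntry.scale]

theorem scale_scale (d : BoxEntry) (m n : ℕ) : (d.scale m).scale n = d.scale (n * m) := by
  cases d <;> simp [BoxEntry.scale, mul_assoc]

/-- The combinatorial shadow of splitting off a hyperbolic plane; the next two lemmas play this role
for definite pairs along the axes. -/
theorem table_succ_succ (s t : Fin 8) :
    table s.succ t.succ = (table s.castSucc t.castSucc).scale 2 := by
  fin_cases s <;> fin_cases t <;> rfl

theorem table_add_two_zero (n : Fin 7) :
    table n.succ.succ 0 = (table 0 n.castSucc.castSucc).scale 2 := by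
  fin_cases n <;> rfl

theorem table_zero_add_two (n : Fin 7) :
    table 0 n.succ.succ = (table n.castSucc.castSucc 0).tensorQuaternion := by
  fin_cases n <;> rfl

/-- Each step by two exchanges the axes, so both must be carried through a single induction. -/
theorem describes_axes (n : ℕ) (h : n < 9) :
    (table ⟨n, h⟩ 0).Describes (RealGeomAlg n 0) ∧
      (table 0 ⟨n, h⟩).Describes (RealGeomAlg 0 n) := by
  induction n using Nat.twoStepInduction with
  | zero =>
    have : (R 1).Describes (RealGeomAlg 0 0) :=
      realGeomAlg_zero_zero.map fun e => e.trans sqMatOneEquiv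
    exact ⟨this, this⟩
  | one =>
    exact ⟨realGeomAlg_one_zero.map fun e =>
        e.trans (AlgEquiv.prodCongr sqMatOneEquiv sqMatOneEquiv),
      realGeomAlg_zero_one.map fun e => e.trans sqMatOneEquiv⟩
  | more n ih _ =>
    obtain ⟨h₁, h₂⟩ := ih (by omega)
    obtain ⟨e⟩ := realGeomAlg_add_two_left_matrix n 0
    obtain ⟨f⟩ := realGeomAlg_add_two_right 0 n
    exact ⟨table_add_two_zero ⟨n, by omega⟩ ▸ (h₂.scale 2).congr e,
      table_zero_add_two ⟨n, by omega⟩ ▸ h₁.tensorQuaternion.congr f⟩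

/-- Descending along a diagonal, one hyperbolic plane at a time, ends on an axis. -/
theorem describes_table (s t : ℕ) (hs : s < 9) (ht : t < 9) :
    (table ⟨s, hs⟩ ⟨t, ht⟩).Describes (RealGeomAlg s t) := by
  induction s generalizing t with
  | zero => exact (describes_axes t ht).2
  | succ s ih =>
    cases t with
    | zero => exact (describes_axes (s + 1) hs).1
    | succ t =>
      obtain ⟨e⟩ := realGeomAlg_hyperbolic s t
      exact table_succ_succ ⟨s, by omega⟩ ⟨t, by omega⟩ ▸
        ((ih t (by omega) (by omega)).scale 2).congr e

theorem describes_add_eight {d : BoxEntry} {s t : ℕ} (h : d.Describes (RealGeomAlg s t))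
    (a b : ℕ) : (d.scale (16 ^ (a + b))).Describes (RealGeomAlg (s + 8 * a) (t + 8 * b)) := by
  induction a with
  | zero =>
    induction b with
    | zero => simpa [scale_one] using h
    | succ b ih =>
      obtain ⟨e⟩ := realGeomAlg_add_eight_right (s + 8 * 0) (t + 8 * b)
      have := (ih.scale 16).congr e
      rwa [scale_scale, ← pow_succ'] at this
  | succ a ih =>
    obtain ⟨e⟩ := realGeomAlg_add_eight_left (s + 8 * a) (t + 8 * b)
    have := (ih.scale 16).congr e
    -- The exponent `a + b + 1` is rearranged to `a + 1 + b`.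
    rwa [scale_scale, ← pow_succ', add_right_comm] at this

end BoxEntry

/-! ### The classification theorem -/

theorem mainTheorem3 :
    -- the classification table
    (∀ s t : Fin 9, (BoxEntry.table s t).Describes (RealGeomAlg s t)) ∧
    -- periodicity of the table
    (∀ s t : ℕ,
      Nonempty (RealGeomAlg (s + 8) t ≃ₐ[ℝ] RealGeomAlg s (t + 8)) ∧
      Nonempty (RealGeomAlg s (t + 8) ≃ₐ[ℝ] RealGeomAlg s t ⊗[ℝ] SqMat ℝ 16)) ∧
    -- the resulting classification in all signatures
    (∀ (s t : Fin 9) (a b : ℕ),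
      ((BoxEntry.table s t).scale (16 ^ (a + b))).Describes
        (RealGeomAlg (s + 8 * a) (t + 8 * b))) ∧
    -- even subalgebras
    (∀ s t : ℕ, 1 ≤ t → Nonempty (RealGeomAlgEven s t ≃ₐ[ℝ] RealGeomAlg s (t - 1))) ∧
    (∀ s t : ℕ, 1 ≤ s → Nonempty (RealGeomAlgEven s t ≃ₐ[ℝ] RealGeomAlg t (s - 1))) ∧
    -- tensor splittings
    (∀ n : ℕ, Nonempty (RealGeomAlg (n + 2) 0 ≃ₐ[ℝ] RealGeomAlg 0 n ⊗[ℝ] RealGeomAlg 2 0)) ∧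
    (∀ n : ℕ, Nonempty (RealGeomAlg 0 (n + 2) ≃ₐ[ℝ] RealGeomAlg n 0 ⊗[ℝ] RealGeomAlg 0 2)) ∧
    (∀ s t : ℕ,
      Nonempty (RealGeomAlg (s + 1) (t + 1) ≃ₐ[ℝ] RealGeomAlg s t ⊗[ℝ] RealGeomAlg 1 1)) ∧
    -- periodicity isomorphisms, real and complex
    (∀ n : ℕ, Nonempty (RealGeomAlg (n + 8) 0 ≃ₐ[ℝ] RealGeomAlg n 0 ⊗[ℝ] RealGeomAlg 8 0)) ∧
    (∀ n : ℕ, Nonempty (RealGeomAlg 0 (n + 8) ≃ₐ[ℝ] RealGeomAlg 0 n ⊗[ℝ] RealGeomAlg 0 8)) ∧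
    (∀ n : ℕ, Nonempty (ComplexGeomAlg (n + 2) ≃ₐ[ℂ] ComplexGeomAlg n ⊗[ℂ] ComplexGeomAlg 2)) ∧
    -- tensor products of the division algebras
    Nonempty (ℂ ⊗[ℝ] ℂ ≃ₐ[ℝ] ℂ × ℂ) ∧
    Nonempty (ℂ ⊗[ℝ] Quaternion ℝ ≃ₐ[ℝ] SqMat ℂ 2) ∧
    Nonempty (Quaternion ℝ ⊗[ℝ] Quaternion ℝ ≃ₐ[ℝ] SqMat ℝ 4) := by
  refine ⟨fun s t => BoxEntry.describes_table s t s.2 t.2, fun s t => ?_,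
    fun s t a b => BoxEntry.describes_add_eight (BoxEntry.describes_table s t s.2 t.2) a b,
    fun s t ht => ?_, fun s t hs => ?_, fun n => ?_, fun n => ?_, fun s t => ?_, fun n => ?_,
    fun n => ?_, fun n => ?_, complex_tensor_complex, complex_tensor_quaternion,
    quaternion_tensor_quaternion⟩
  · obtain ⟨e⟩ := realGeomAlg_add_eight_left s t
    obtain ⟨f⟩ := realGeomAlg_add_eight_right s t
    exact ⟨⟨e.trans f.symm⟩, ⟨f⟩⟩
  · obtain ⟨t, rfl⟩ := Nat.exists_eq_add_of_le' ht
    exact realGeomAlgEven_succ_right s t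
  · obtain ⟨s, rfl⟩ := Nat.exists_eq_add_of_le' hs
    -- Reversing the signature turns the distinguished positive vector into a negative one, to which
    -- the previous case applies.
    obtain ⟨e⟩ := realGeomAlgEven_swap (s + 1) t
    obtain ⟨f⟩ := realGeomAlgEven_succ_right t s
    exact ⟨e.trans f⟩
  · obtain ⟨e⟩ := realGeomAlg_add_two_left_matrix n 0
    obtain ⟨f⟩ := realGeomAlg_two_zero
    exact ⟨e.trans (Algebra.TensorProduct.congr .refl f.symm)⟩
  · obtain ⟨e⟩ := realGeomAlg_add_two_right 0 n
    obtain ⟨f⟩ := realGeomAlg_zero_two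
    exact ⟨e.trans (Algebra.TensorProduct.congr .refl f.symm)⟩
  · obtain ⟨e⟩ := realGeomAlg_hyperbolic s t
    obtain ⟨f⟩ := realGeomAlg_one_one
    exact ⟨e.trans (Algebra.TensorProduct.congr .refl f.symm)⟩
  · obtain ⟨e⟩ := realGeomAlg_add_eight_left n 0
    obtain ⟨f⟩ := realGeomAlg_eight_zero
    exact ⟨e.trans (Algebra.TensorProduct.congr .refl f.symm)⟩
  · obtain ⟨e⟩ := realGeomAlg_add_eight_right 0 n
    obtain ⟨f⟩ := realGeomAlg_zero_eight
    exact ⟨e.trans (Algebra.TensorProduct.congr .refl f.symm)⟩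
  · obtain ⟨e⟩ := complexGeomAlg_add_two n
    obtain ⟨f⟩ := complexGeomAlg_two
    exact ⟨e.trans (Algebra.TensorProduct.congr .refl f.symm)⟩
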